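/- For a family $\mathcal F$ of subsets of $[n]=\{1,\dots,n\}$ and $S\subset[n]$ let $\mathcal F(\overline S)=\{F\in\mathcal F: F\cap S=\emptyset\}$, and let $\gamma_\ell(\mathcal F)=\min\{|\mathcal F(\overline S)| : S\subset [n],\ |S|=\ell\}$ be the $\ell$-diversity of $\mathcal F$. Call $\mathcal F$ intersecting if $F\cap F'\neq\emptyset$ for all $F,F'\in\mathcal F$, and let $\tau(\mathcal F)$ be the minimum size of a set $T\subset[n]$ that meets every member of $\mathcal F$. Let $m_\ell(k)$ be the maximum of $\gamma_\ell(\mathcal F)$ over all $n$ and all intersecting families $\mathcal F\subset\binom{[n]}{k}$ with $\tau(\mathcal F)=k$. **Proposition.** Let $n\ge 3$ and let $\mathcal F\subset\binom{[n]}{4}$ be an intersecting family. Then $\gamma_3(\mathcal F)\le 3$. Moreover, $m_3(4)=3$; the maximum exists and is attained, for example, by the projective plane of order $3$, that is, by the family $\mathcal L_3=\{\{i,i+1,i+3,i+9\}: i\in\mathbb Z_{13}\}$: it is the family of lines of a projective plane of order $3$ (on $13$ points, with $4$ points on every line and exactly one line through any two distinct points), it is intersecting, $\tau(\mathcal L_3)=4$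 and $\gamma_3(\mathcal L_3)=3$. -/

import Mathlib

namespace Diversity

/-- `F(S̄)`: the members of the family `F` that are disjoint from `S`. -/
def avoiding {α : Type*} [DecidableEq α] (F : Finset (Finset α)) (S : Finset α) :
    Finset (Finset α) :=
  F.filter (fun A => Disjoint A S)

/-- The `ℓ`-diversity `γ_ℓ(F)`: the minimum of `|F(S̄)|` over all `ℓ`-subsets `S` of the
ground set `α` (a genuine minimum as soon as the ground set has at least `ℓ` elements). -/
noncomputable def diversity {α : Type*} [DecidableEq α] (ℓ : ℕ) (F : Finset (Finset α)) : ℕ :=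
  sInf {d : ℕ | ∃ S : Finset α, S.card = ℓ ∧ (avoiding F S).card = d}

/-- `T` is a transversal (cover) of `F`: it meets every member of `F`. -/
def IsTransversal {α : Type*} [DecidableEq α] (F : Finset (Finset α)) (T : Finset α) : Prop :=
  ∀ A ∈ F, (A ∩ T).Nonempty

/-- The covering number `τ(F)`: the minimum size of a transversal of `F`. -/
noncomputable def coveringNumber {α : Type*} [DecidableEq α] (F : Finset (Finset α)) : ℕ :=
  sInf {t : ℕ | ∃ T : Finset α, IsTransversal F T ∧ T.card = t}

/-- The values `γ_ℓ(F)` over all `n` and all intersecting `k`-uniform families `F` of subsets of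
an `n`-element set with `τ(F) = k`; the number `m_ℓ(k)` is the maximum of this set. -/
def diversityValues (ℓ k : ℕ) : Set ℕ :=
  {d : ℕ | ∃ (n : ℕ) (F : Finset (Finset (Fin n))),
    (F : Set (Finset (Fin n))).Sized k ∧ (F : Set (Finset (Fin n))).Intersecting ∧
      coveringNumber F = k ∧ diversity ℓ F = d}

/-- `F` is the family of lines of a projective plane of order `q` with point set `α`:
there are `q² + q + 1` points, each line has `q + 1` points, and any two distinct points
lie on exactly one line. -/
def IsProjectivePlaneOfOrder {α : Type*} [Fintype α] (q : ℕ) (F : Finset (Finset α)) : Prop :=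
  2 ≤ q ∧ Fintype.card α = q ^ 2 + q + 1 ∧ (F : Set (Finset α)).Sized (q + 1) ∧
    ∀ x y : α, x ≠ y → ∃! A : Finset α, A ∈ F ∧ x ∈ A ∧ y ∈ A

/-- The family `{i, i + 1, i + 3, i + 9}`, `i` an integer modulo `13` (addition in `Fin 13` is
modulo `13`). -/
def planeOfOrderThree : Finset (Finset (Fin 13)) :=
  Finset.univ.image (fun i : Fin 13 => {i, i + 1, i + 3, i + 9})

end Diversity

/-! ### The search procedure. -/

namespace Diversity

/-! Suppose every set of at most three points is avoided by at least four edges. The possible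
intersections are then cut down in turn: no three edges share a triple (`Spread.three_edges`), no
two share a triple (`Spread.two_edges_triple`), no two share a pair (`Spread.two_edges_pair`). What
remains is a family whose edges pairwise meet in one point. It is impossible too: the four edges
avoiding three points of an edge `E` all pass through its fourth point `x`, so with `E` five edges
meet only in `x`, and an edge avoiding `x` would need five points.

Each step starts from a few edges in known position and is settled by a finite search, checked by
the kernel. A stage picks at most three labelled points; at least four edges avoid them, and each is
known or has one of the recorded traces on the labelled points. A trace is refuted by adding an edge
with that trace, labelling its new points and searching on. Once at most three edges can remain, the
stage is contradictory. `not_describes_of_refute` proves this sound.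

The plane of order 3 attains the bound by finite verification. -/

/-- A stage of the search. There are `size` labelled points, and a set of labels is coded by the
natural number whose binary digits are its indicator. `known` lists the codes of edges found so
far; `pool` lists the possible pairs (labels in `E`, number of unlabelled points of `E`) for the
remaining edges `E`. -/
structure Search where
  size : ℕ
  known : List ℕ
  pool : List (ℕ × ℕ)

/-- Whether `m` has at least `r` binary digits equal to `1`. -/
def atLeast : ℕ → ℕ → Bool
  | 0, _ => true
  | r + 1, m => !Nat.beq m 0 && atLeast r (Nat.land m (m - 1))

namespace Search

/-- The search with nothing known. -/
def init : Search := ⟨0, [], [(0, 4)]⟩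

/-- Give a label to one more point. -/
def label (s : Search) : Search :=
  ⟨s.size + 1, s.known, s.pool.flatMap fun c =>
    match c.2 with
    | 0 => [c]
    | l + 1 => [c, (c.1 + 2 ^ s.size, l)]⟩

/-- Add the edge with code `K`. Remaining edges meet it in at least one and fewer than `a`
points, and contain fewer than `b` points of its intersection with a known edge. -/
def insert (a b : ℕ) (s : Search) (K : ℕ) : Search :=
  ⟨s.size, K :: s.known,
    let near := (s.known.map (Nat.land K)).filter (atLeast b)
    s.pool.filter fun c =>
      !Nat.beq (Nat.land c.1 K) 0 && !atLeast a (Nat.land c.1 K) &&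
        near.all fun t => !atLeast b (Nat.land c.1 t)⟩

/-- Add an edge with labels `m` and `l` unlabelled points. -/
def add (a b : ℕ) : Search → ℕ → ℕ → Search
  | s, m, 0 => s.insert a b m
  | s, m, l + 1 => add a b s.label (m + 2 ^ s.size) l

/-- Remove an entry from the pool. -/
def erase (s : Search) (c : ℕ × ℕ) : Search :=
  ⟨s.size, s.known, s.pool.filter fun d => !(Nat.beq d.1 c.1 && Nat.beq d.2 c.2)⟩

/-- Try the entries of a list in turn as new edges, refuting each by `g`, until `k` and the
number of entries left sum to less than four. -/
def branch (a b k : ℕ) (g : Search → List ℕ → Option (List ℕ)) :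
    Search → List (ℕ × ℕ) → List ℕ → Option (List ℕ)
  | _, [], ts => if Nat.ble k 3 then some ts else none
  | s, c :: cs, ts =>
    -- An entry without unlabelled points stands for at most one edge and can be counted; any other
    -- may stand for many edges and has to be refuted.
    if Nat.ble (k + (cs.length + 1)) 3 && (c :: cs).all fun d => Nat.beq d.2 0 then some ts
    else
      match g (s.add a b c.1 c.2) ts with
      | none => none
      | some ts' => branch a b k g (s.erase c) cs ts'

/-- Refute the search: the stream gives for each stage, in depth-first order, a set of at most
three labels that too few edges can avoid. The unused part of the stream is returned. -/
def refute (a b : ℕ) : ℕ → Search → List ℕ → Option (List ℕ)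
  | 0, _, _ => none
  | _ + 1, _, [] => none
  | fuel + 1, s, T :: ts =>
    if Nat.ble ((List.range s.size).filter T.testBit).length 3 then
      let cs := s.pool.filter fun c => Nat.beq (Nat.land c.1 T) 0
      branch a b (s.known.filter fun K => Nat.beq (Nat.land K T) 0).length (refute a b fuel) s
        -- The entries that cannot be counted come first, so that `branch` may stop early among the
        -- others.
        ((cs.filter fun c => !Nat.beq c.2 0) ++ cs.filter fun c => Nat.beq c.2 0) ts
    else none

/-- The search with `n` labelled points and nothing known. -/
def blank : ℕ → Search
  | 0 => init
  | n + 1 => (blank n).label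

/-- The search with `n` labelled points and known edges `Ks`. -/
def start (a b n : ℕ) (Ks : List ℕ) : Search :=
  Ks.foldr (fun K s => s.insert a b K) (blank n)

end Search

end Diversity

namespace Diversity

/-! ### Binary codes of sets of labelled points. -/

variable {α : Type*} [DecidableEq α]

/-- The binary code of the set of those points of `l` that lie in `E`; the label of a point is
its position counted from the end of `l`. -/
def code (l : List α) (E : Finset α) : ℕ :=
  match l with
  | [] => 0
  | z :: l => (if z ∈ E then 2 ^ l.length else 0) + code l E

theorem code_lt (l : List α) (E : Finset α) : code l E < 2 ^ l.length := by
  induction l with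
  | nil => simp [code]
  | cons z l ih =>
    simp only [code, List.length_cons, pow_succ]
    split_ifs <;> omega

theorem testBit_code (l : List α) (E : Finset α) (i : ℕ) :
    (code l E).testBit i = true ↔ ∃ z, l.reverse[i]? = some z ∧ z ∈ E := by
  induction l with
  | nil => simp [code]
  | cons z l ih =>
    have hlt := code_lt l E
    rw [List.reverse_cons, code]
    rcases lt_trichotomy i l.length with h | h | h
    · rw [List.getElem?_append_left (by simpa using h), ← ih]
      split_ifs
      · rw [Nat.testBit_two_pow_add_gt h]
      · simp
    · subst h
      have h0 : (code l E).testBit l.length = false := Nat.testBit_lt_two_pow hlt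
      split_ifs with hz
      · simp [Nat.testBit_two_pow_add_eq, h0, hz]
      · simp [h0, hz]
    · have h1 : ((if z ∈ E then 2 ^ l.length else 0) + code l E).testBit i = false := by
        apply Nat.testBit_lt_two_pow
        have : 2 ^ (l.length + 1) ≤ 2 ^ i := Nat.pow_le_pow_right (by norm_num) h
        rw [pow_succ] at this
        split_ifs <;> omega
      have h2 : (l.reverse ++ [z])[i]? = none := by
        simp; omega
      simp [h1, h2]

theorem land_code (l : List α) (E E' : Finset α) :
    Nat.land (code l E) (code l E') = code l (E ∩ E') := by
  apply Nat.eq_of_testBit_eq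
  intro i
  rw [Bool.eq_iff_iff]
  change (code l E &&& code l E').testBit i = true ↔ _
  simp only [Nat.testBit_and, Bool.and_eq_true, testBit_code, Finset.mem_inter]
  constructor
  · rintro ⟨⟨z, hz, h⟩, w, hw, h'⟩
    obtain rfl : z = w := by simpa [hz] using hw
    exact ⟨z, hz, h, h'⟩
  · rintro ⟨z, hz, h, h'⟩
    exact ⟨⟨z, hz, h⟩, z, hz, h'⟩

theorem exists_testBit_code {l : List α} {E : Finset α} {z : α} (hz : z ∈ l) (hE : z ∈ E) :
    ∃ i, l.reverse[i]? = some z ∧ (code l E).testBit i = true := by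
  obtain ⟨i, hi⟩ := List.mem_iff_getElem?.1 (List.mem_reverse.2 hz)
  exact ⟨i, hi, (testBit_code l E i).2 ⟨z, hi, hE⟩⟩

theorem code_ne_zero {l : List α} {E : Finset α} {z : α} (hz : z ∈ l) (hE : z ∈ E) :
    code l E ≠ 0 := by
  obtain ⟨i, -, hi⟩ := exists_testBit_code hz hE
  intro h
  simp [h] at hi

theorem eq_of_code_eq {l : List α} {E E' : Finset α} (hE : E ⊆ l.toFinset) (hE' : E' ⊆ l.toFinset)
    (h : code l E = code l E') : E = E' := by
  have key : ∀ {A B : Finset α}, A ⊆ l.toFinset → code l A = code l B → A ⊆ B := by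
    intro A B hA hAB z hz
    obtain ⟨i, hi, ht⟩ := exists_testBit_code (List.mem_toFinset.1 (hA hz)) hz
    rw [hAB, testBit_code] at ht
    obtain ⟨w, hw, hwB⟩ := ht
    obtain rfl : z = w := by simpa [hi] using hw
    exact hwB
  exact (key hE h).antisymm (key hE' h.symm)

theorem le_card_of_atLeast (r m : ℕ) (s : Finset ℕ) (hs : ∀ i, m.testBit i = true → i ∈ s)
    (h : atLeast r m = true) : r ≤ s.card := by
  induction r generalizing m s with
  | zero => simp
  | succ r ih =>
    simp only [atLeast, Bool.and_eq_true, Bool.not_eq_true'] at h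
    have hm : m ≠ 0 := by
      rintro rfl
      simp at h
    -- Each round of `atLeast` loses at least one digit, which is all that the lower bound needs.
    have hlt : m &&& (m - 1) ≠ m := by
      have := Nat.and_le_right (n := m) (m := m - 1)
      omega
    obtain ⟨i, hi⟩ := Nat.exists_testBit_ne_of_ne hlt
    have hi1 : m.testBit i = true ∧ (m &&& (m - 1)).testBit i = false := by
      revert hi
      rw [Nat.testBit_and]
      cases m.testBit i <;> simp
    have := ih (m &&& (m - 1)) (s.erase i) (fun j hj => by
      refine Finset.mem_erase.2 ⟨?_, hs j ?_⟩
      · rintro rfl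
        simp [hi1.2] at hj
      · rw [Nat.testBit_and, Bool.and_eq_true] at hj
        exact hj.1) h.2
    rw [Finset.card_erase_of_mem (hs i hi1.1)] at this
    have : 0 < s.card := Finset.card_pos.2 ⟨i, hs i hi1.1⟩
    omega

theorem le_card_of_atLeast_code {l : List α} (hl : l.Nodup) {E : Finset α} {r : ℕ}
    (h : atLeast r (code l E) = true) : r ≤ E.card := by
  refine (le_card_of_atLeast r _ (E.image fun z => l.reverse.idxOf z) (fun i hi => ?_) h).trans
    Finset.card_image_le
  obtain ⟨z, hz, hzE⟩ := (testBit_code l E i).1 hi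
  refine Finset.mem_image.2 ⟨z, hzE, ?_⟩
  obtain ⟨hlt, rfl⟩ := List.getElem?_eq_some_iff.1 hz
  exact (List.nodup_reverse.2 hl).idxOf_getElem i hlt

/-- The points of `l` whose labels are the binary digits of `T`. -/
def decode (l : List α) (T : ℕ) : Finset α :=
  (((List.range l.length).filter T.testBit).filterMap fun i => l.reverse[i]?).toFinset

theorem card_decode_le (l : List α) (T : ℕ) :
    (decode l T).card ≤ ((List.range l.length).filter T.testBit).length :=
  (List.toFinset_card_le _).trans (List.length_filterMap_le _ _)

theorem land_code_eq_zero {l : List α} {E : Finset α} {T : ℕ} (h : Disjoint E (decode l T)) :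
    Nat.land (code l E) T = 0 := by
  apply Nat.eq_of_testBit_eq
  intro i
  rw [Nat.zero_testBit, ← Bool.not_eq_true]
  change ¬ (code l E &&& T).testBit i = true
  rw [Nat.testBit_and, Bool.and_eq_true, testBit_code]
  rintro ⟨⟨z, hz, hzE⟩, hT⟩
  refine Finset.disjoint_left.1 h hzE ?_
  rw [decode, List.mem_toFinset, List.mem_filterMap]
  refine ⟨i, List.mem_filter.2 ⟨List.mem_range.2 ?_, hT⟩, hz⟩
  simpa using (List.getElem?_eq_some_iff.1 hz).1

/-! ### Soundness of the search. -/

/-- `F` is an intersecting family of four-element sets at least four of which avoid any given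
set of at most three points, distinct members of `F` share fewer than `a` points, and three
distinct members share fewer than `b` points. -/
structure Spread (F : Finset (Finset α)) (a b : ℕ) : Prop where
  card_eq : ∀ E ∈ F, E.card = 4
  inter_nonempty : ∀ E ∈ F, ∀ E' ∈ F, (E ∩ E').Nonempty
  four_le : ∀ S : Finset α, S.card ≤ 3 → 4 ≤ (avoiding F S).card
  card_inter_lt : ∀ E ∈ F, ∀ E' ∈ F, E ≠ E' → (E ∩ E').card < a
  card_inter_inter_lt : ∀ E₁ ∈ F, ∀ E₂ ∈ F, ∀ E₃ ∈ F, E₁ ≠ E₂ → E₁ ≠ E₃ → E₂ ≠ E₃ →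
    (E₁ ∩ (E₂ ∩ E₃)).card < b

namespace Search

/-- The edge `E` is among the known edges of `s`, where `l` lists the labelled points. -/
def Knows (s : Search) (l : List α) (E : Finset α) : Prop :=
  code l E ∈ s.known ∧ E ⊆ l.toFinset

/-- The list `l` of labelled points (last label first) makes all that `s` records true of `F`. -/
structure Describes (s : Search) (F : Finset (Finset α)) (l : List α) : Prop where
  nodup : l.Nodup
  size_eq : s.size = l.length
  exists_of_known : ∀ K ∈ s.known, ∃ E ∈ F, code l E = K ∧ E ⊆ l.toFinset
  knows_or : ∀ E ∈ F, s.Knows l E ∨ (code l E, (E \ l.toFinset).card) ∈ s.pool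

variable {F : Finset (Finset α)} {s : Search} {l : List α} {a b : ℕ}

theorem describes_init (h : ∀ E ∈ F, E.card = 4) : init.Describes F [] where
  nodup := List.nodup_nil
  size_eq := rfl
  exists_of_known := by simp [init]
  knows_or := fun E hE => by simp [init, code, h E hE]

theorem code_cons_of_notMem {z : α} {E : Finset α} (hz : z ∉ E) : code (z :: l) E = code l E := by
  simp [code, hz]

/-- The new point takes a new highest digit, so known edges keep their codes, while the trace of any
other edge either stays or gains this digit and loses one unlabelled point. -/
theorem Describes.label (hs : s.Describes F l) {z : α} (hz : z ∉ l) :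
    s.label.Describes F (z :: l) where
  nodup := List.nodup_cons.2 ⟨hz, hs.nodup⟩
  size_eq := by simp [Search.label, hs.size_eq]
  exists_of_known := fun K hK => by
    obtain ⟨E, hE, hc, hl⟩ := hs.exists_of_known K hK
    have hzE : z ∉ E := fun h => hz (List.mem_toFinset.1 (hl h))
    exact ⟨E, hE, by rw [code_cons_of_notMem hzE, hc],
      hl.trans (by rw [List.toFinset_cons]; exact Finset.subset_insert _ _)⟩
  knows_or := fun E hE => by
    rcases hs.knows_or E hE with ⟨hc, hl⟩ | hp
    · have hzE : z ∉ E := fun h => hz (List.mem_toFinset.1 (hl h))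
      exact Or.inl ⟨by rwa [code_cons_of_notMem hzE],
        hl.trans (by rw [List.toFinset_cons]; exact Finset.subset_insert _ _)⟩
    · right
      refine List.mem_flatMap.2 ⟨_, hp, ?_⟩
      by_cases hzE : z ∈ E
      · have hmem : z ∈ E \ l.toFinset := by simp [hzE, hz]
        obtain ⟨m, hm⟩ := Nat.exists_eq_succ_of_ne_zero (Finset.card_pos.2 ⟨z, hmem⟩).ne'
        rw [List.toFinset_cons, Finset.sdiff_insert, Finset.card_erase_of_mem hmem, hm, code,
          if_pos hzE, ← hs.size_eq, add_comm]
        simp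
      · rw [List.toFinset_cons, Finset.sdiff_insert, Finset.erase_eq_of_notMem (by simp [hzE]),
          code_cons_of_notMem hzE]
        cases (E \ l.toFinset).card <;> simp

/-- Since all points of `E` are labelled, the codes show the whole of `E' ∩ E`, even if `E'` has
unlabelled points. That `E` is new makes it distinct from the known edges in the condition on three
edges. -/
theorem Describes.insert (hF : Spread F a b) (hs : s.Describes F l) {E : Finset α} (hE : E ∈ F)
    (hEs : ¬ s.Knows l E) (hl : E ⊆ l.toFinset) :
    (s.insert a b (code l E)).Describes F l where
  nodup := hs.nodup
  size_eq := hs.size_eq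
  exists_of_known := fun K hK => by
    rcases List.mem_cons.1 hK with rfl | hK
    · exact ⟨E, hE, rfl, hl⟩
    · exact hs.exists_of_known K hK
  knows_or := fun E' hE' => by
    by_cases hEE : E' = E
    · subst hEE
      exact Or.inl ⟨List.mem_cons_self, hl⟩
    rcases hs.knows_or E' hE' with hk | hp
    · exact Or.inl ⟨List.mem_cons_of_mem _ hk.1, hk.2⟩
    by_cases hk : s.Knows l E'
    · exact Or.inl ⟨List.mem_cons_of_mem _ hk.1, hk.2⟩
    right
    refine List.mem_filter.2 ⟨hp, ?_⟩
    simp only [Bool.and_eq_true, Bool.not_eq_true', land_code, List.all_eq_true]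
    refine ⟨⟨?_, ?_⟩, fun t ht => ?_⟩
    · obtain ⟨z, hz⟩ := hF.inter_nonempty E' hE' E hE
      have := code_ne_zero (List.mem_toFinset.1 (hl (Finset.mem_inter.1 hz).2)) hz
      exact Bool.eq_false_iff.2 fun h => this (Nat.eq_of_beq_eq_true h)
    · rw [← Bool.not_eq_true]
      exact fun h => (le_card_of_atLeast_code hs.nodup h).not_gt (hF.card_inter_lt E' hE' E hE hEE)
    · obtain ⟨K, hK, rfl⟩ := List.mem_map.1 (List.mem_filter.1 ht).1
      obtain ⟨E₁, hE₁, rfl, hl₁⟩ := hs.exists_of_known K hK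
      rw [land_code, land_code, ← Bool.not_eq_true]
      refine fun h => (le_card_of_atLeast_code hs.nodup h).not_gt
        (hF.card_inter_inter_lt E' hE' E hE E₁ hE₁ hEE ?_ ?_)
      · rintro rfl
        exact hk ⟨hK, hl₁⟩
      · rintro rfl
        exact hEs ⟨hK, hl₁⟩

theorem Describes.exists_add (hF : Spread F a b) {E : Finset α} (hE : E ∈ F) (n : ℕ)
    (hs : s.Describes F l) (hEs : ¬ s.Knows l E) (hn : (E \ l.toFinset).card = n) :
    ∃ l' : List α, (s.add a b (code l E) n).Describes F l' := by
  induction n generalizing s l with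
  | zero =>
    exact ⟨l, hs.insert hF hE hEs (by simpa using hn)⟩
  | succ n ih =>
    obtain ⟨z, hz⟩ : (E \ l.toFinset).Nonempty := Finset.card_pos.1 (by omega)
    obtain ⟨hzE, hzl⟩ := Finset.mem_sdiff.1 hz
    have hzl' : z ∉ l := fun h => hzl (List.mem_toFinset.2 h)
    have := ih (hs.label hzl') ?_ ?_
    · rw [code, if_pos hzE, add_comm, ← hs.size_eq] at this
      exact this
    -- `E` is still unknown: its code now has the digit of `z`, while the recorded codes are below
    -- `2 ^ l.length`.
    · rintro ⟨hc, -⟩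
      obtain ⟨E₁, -, h₁, -⟩ := hs.exists_of_known _ hc
      have := code_lt l E₁
      rw [code, if_pos hzE] at h₁
      omega
    · rw [List.toFinset_cons, Finset.sdiff_insert, Finset.card_erase_of_mem hz, hn]
      rfl

theorem Describes.erase (hs : s.Describes F l) {c : ℕ × ℕ}
    (hc : ∀ E ∈ F, (code l E, (E \ l.toFinset).card) = c → s.Knows l E) :
    (s.erase c).Describes F l where
  nodup := hs.nodup
  size_eq := hs.size_eq
  exists_of_known := hs.exists_of_known
  knows_or := fun E hE => by
    by_cases hk : s.Knows l E
    · exact Or.inl hk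
    · refine Or.inr (List.mem_filter.2 ⟨(hs.knows_or E hE).resolve_left hk, ?_⟩)
      rw [Bool.not_eq_true', ← Bool.not_eq_true, Bool.and_eq_true]
      exact fun h => hk (hc E hE
        (Prod.ext (Nat.eq_of_beq_eq_true h.1) (Nat.eq_of_beq_eq_true h.2)))

theorem card_avoiding_le (S : Finset α) (L : List ℕ)
    (h : ∀ E ∈ avoiding F S, code l E ∈ L ∧ E ⊆ l.toFinset) : (avoiding F S).card ≤ L.length := by
  refine le_trans ?_ (List.toFinset_card_le L)
  refine Finset.card_le_card_of_injOn (code l) (fun E hE => ?_) fun E hE E' hE' he => ?_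
  · exact List.mem_toFinset.2 (h E hE).1
  · exact eq_of_code_eq (h E hE).2 (h E' hE').2 he

/-- Every edge avoiding `S` stays known or listed in `cs`: after an entry is refuted, any edge with
that trace must be known. At the end all these edges are fully labelled, hence determined by their
codes, of which there are at most three. -/
theorem branch_sound (hF : Spread F a b) {g : Search → List ℕ → Option (List ℕ)}
    (hg : ∀ s ts, (g s ts).isSome = true → ∀ l : List α, ¬ s.Describes F l)
    {S : Finset α} (hS : S.card ≤ 3) (k : List ℕ) (cs : List (ℕ × ℕ)) (ts : List ℕ)
    (hs : s.Describes F l) (hk : ∀ E ∈ avoiding F S, s.Knows l E → code l E ∈ k)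
    (hcs : ∀ E ∈ avoiding F S, s.Knows l E ∨ (code l E, (E \ l.toFinset).card) ∈ cs)
    (h : (branch a b k.length g s cs ts).isSome = true) : False := by
  have h4 := hF.four_le S hS
  induction cs generalizing s ts with
  | nil =>
    rw [branch] at h
    have hle := card_avoiding_le S k fun E hE => by
      have := (hcs E hE).resolve_right List.not_mem_nil
      exact ⟨hk E hE this, this.2⟩
    split_ifs at h with hk3
    · have := Nat.le_of_ble_eq_true hk3
      omega
    · simp at h
  | cons c cs ih =>
    rw [branch] at h
    split_ifs at h with hk3
    · simp only [Bool.and_eq_true, List.all_eq_true] at hk3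
      have hle := card_avoiding_le (l := l) S (k ++ (c :: cs).map Prod.fst) fun E hE => by
        rcases hcs E hE with h' | h'
        · exact ⟨List.mem_append_left _ (hk E hE h'), h'.2⟩
        · refine ⟨List.mem_append_right _ (List.mem_map.2 ⟨_, h', rfl⟩), ?_⟩
          simpa using Nat.eq_of_beq_eq_true (hk3.2 _ h')
      have := Nat.le_of_ble_eq_true hk3.1
      rw [List.length_append, List.length_map, List.length_cons] at hle
      omega
    · cases hg' : g (s.add a b c.1 c.2) ts with
      | none => simp [hg'] at h
      | some ts' =>
        have hc : ∀ E ∈ F, (code l E, (E \ l.toFinset).card) = c → s.Knows l E := by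
          rintro E hE rfl
          by_contra hE'
          obtain ⟨l', hl'⟩ := hs.exists_add hF hE _ hE' rfl
          exact hg _ ts (by simp [hg']) l' hl'
        refine ih ts' (hs.erase hc) hk (fun E hE => ?_) (by simpa [hg'] using h)
        rcases hcs E hE with h' | h'
        · exact Or.inl h'
        · rcases List.mem_cons.1 h' with h' | h'
          · exact Or.inl (hc E (Finset.mem_filter.1 hE).1 h')
          · exact Or.inr h'

theorem not_describes_of_refute (hF : Spread F a b) (fuel : ℕ) (s : Search) (ts : List ℕ)
    (h : (refute a b fuel s ts).isSome = true) (l : List α) : ¬ s.Describes F l := by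
  induction fuel generalizing s ts l with
  | zero => simp [refute] at h
  | succ fuel ih =>
    intro hs
    cases ts with
    | nil => simp [refute] at h
    | cons T ts =>
      rw [refute] at h
      split_ifs at h with hT
      · have hT := Nat.le_of_ble_eq_true hT
        rw [hs.size_eq] at hT
        have hz : ∀ E ∈ avoiding F (decode l T), Nat.beq (Nat.land (code l E) T) 0 = true :=
          fun E hE => by rw [land_code_eq_zero (Finset.mem_filter.1 hE).2]; rfl
        refine branch_sound hF ih ((card_decode_le l T).trans hT) _ _ ts hs
          (fun E hE hk => List.mem_filter.2 ⟨hk.1, hz E hE⟩) (fun E hE => ?_) h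
        refine (hs.knows_or E (Finset.mem_filter.1 hE).1).imp_right fun hp => ?_
        have hp : (code l E, (E \ l.toFinset).card) ∈
            s.pool.filter fun c => Nat.beq (Nat.land c.1 T) 0 := List.mem_filter.2 ⟨hp, hz E hE⟩
        cases hb : Nat.beq (E \ l.toFinset).card 0
        · exact List.mem_append_left _ (List.mem_filter.2 ⟨hp, by simp [hb]⟩)
        · exact List.mem_append_right _ (List.mem_filter.2 ⟨hp, by simp [hb]⟩)
      · simp at h

theorem describes_blank (h : ∀ E ∈ F, E.card = 4) (hl : l.Nodup) :
    (blank l.length).Describes F l := by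
  induction l with
  | nil => exact describes_init h
  | cons z l ih => exact (ih (List.nodup_cons.1 hl).2).label (List.nodup_cons.1 hl).1

theorem describes_start (hF : Spread F a b) (hl : l.Nodup) (Es : List (Finset α))
    (hEs : Es.Nodup) (h : ∀ E ∈ Es, E ∈ F ∧ E ⊆ l.toFinset) :
    (start a b l.length (Es.map (code l))).Describes F l ∧
      (start a b l.length (Es.map (code l))).known = Es.map (code l) := by
  induction Es with
  | nil =>
    refine ⟨describes_blank hF.card_eq hl, ?_⟩
    have : ∀ n, (blank n).known = [] := fun n => by
      induction n with
      | zero => rfl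
      | succ n ih => exact ih
    exact this _
  | cons E Es ih =>
    obtain ⟨hd, hk⟩ := ih (List.nodup_cons.1 hEs).2 fun E' hE' => h E' (List.mem_cons_of_mem _ hE')
    obtain ⟨hE, hEl⟩ := h E List.mem_cons_self
    refine ⟨hd.insert hF hE ?_ hEl, congrArg (code l E :: ·) hk⟩
    rintro ⟨hc, -⟩
    rw [hk] at hc
    obtain ⟨E', hE', he⟩ := List.mem_map.1 hc
    obtain rfl := eq_of_code_eq (h E' (List.mem_cons_of_mem _ hE')).2 hEl he
    exact (List.nodup_cons.1 hEs).1 hE'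

/-- A family containing edges coded by `Ks` with respect to the points of `l` is impossible if
the search from `Ks` can be refuted. -/
theorem false_of_refute (hF : Spread F a b) (hl : l.Nodup) {n : ℕ} (hn : l.length = n)
    (Es : List (Finset α)) {Ks : List ℕ} (hKs : Es.map (code l) = Ks) (hnd : Ks.Nodup)
    (h : ∀ E ∈ Es, E ∈ F ∧ E ⊆ l.toFinset) {fuel : ℕ} {ts : List ℕ}
    (hr : (refute a b fuel (start a b n Ks) ts).isSome = true) : False := by
  subst hn hKs
  exact not_describes_of_refute hF fuel _ ts hr l
    (describes_start hF hl Es (List.Nodup.of_map _ hnd) h).1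

end Search
end Diversity

/-! ### The four refutations. -/

namespace Diversity.Search

/-- Edges avoiding the common triple, coded 7, contain the three other points, coded 56. Three such
edges have fourth points that every edge avoiding 56 contains, together with a point of the triple:
only three edges are possible. -/
theorem refute_three_through_triple : (refute 4 4 40 (start 4 4 6 [39, 23, 15])
    [7, 7, 7, 56]).isSome = true := by
  decide +kernel

-- The edges 15 and 23 share the triple 7; the edges 120 and 184 share the triple 56, which contains
-- the two remaining points of the first pair.
set_option maxRecDepth 100000 in
set_option maxHeartbeats 4000000 in
theorem refute_chain_of_triples : (refute 4 3 40 (start 4 3 8 [184, 120, 23, 15])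
    [7, 56, 56, 56, 56, 196, 194, 194, 194, 196, 194, 196, 784, 194, 196, 784, 800, 194, 776,
    800, 194, 194, 194, 194, 196, 784, 800, 194, 196, 196, 194, 776, 800, 196, 196, 704, 448, 7,
    448, 7, 517, 88, 517, 152, 704, 448, 7, 262, 88, 262, 152, 280, 644, 580, 280, 546, 56, 704,
    448, 7, 448, 7, 518, 88, 518, 152, 704, 448, 7, 261, 88, 261, 152, 280, 644, 580, 280, 545,
    56, 196, 193, 196, 196, 776, 800, 196, 784, 800, 193, 196, 193, 196, 196, 784, 800, 193,
    196, 776, 800, 193, 193, 193, 196, 196, 770, 193, 193, 193, 196, 196, 193, 56, 56, 704, 448,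
    7, 448, 7, 515, 88, 515, 152, 704, 448, 7, 262, 88, 262, 152, 448, 536, 386, 322, 536, 289,
    56, 56, 704, 448, 7, 448, 7, 515, 88, 515, 152, 704, 448, 7, 261, 88, 261, 152, 448, 280,
    641, 88, 515, 261, 11, 261, 261, 784, 641, 56, 56, 56, 704, 448, 7, 448, 7, 518, 88, 518,
    152, 704, 448, 7, 259, 88, 259, 152, 280, 642, 578, 280, 545, 56, 704, 448, 7, 448, 7, 517,
    88, 517, 152, 704, 448, 7, 259, 88, 259, 152, 448, 536, 385, 88, 259, 259, 11, 517, 517,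
    784, 385, 56, 56, 56, 56, 193, 193, 193, 194, 776, 800, 194, 776, 800, 193, 194, 784, 800,
    194, 784, 800, 194, 193, 194, 193, 194, 193, 193, 194, 772, 193, 194, 193, 193, 194, 193,
    193, 7, 88, 88, 88, 88, 152, 152, 290, 644, 644, 98, 644, 98, 112, 290, 292, 672, 84, 290,
    290, 292, 704, 290, 290, 352, 352, 517, 152, 352, 352, 515, 672, 672, 261, 152, 88, 672,
    672, 262, 152, 88, 152, 152, 352, 352, 518, 289, 644, 112, 104, 644, 289, 292, 672, 84, 289,
    289, 292, 704, 289, 289, 152, 352, 352, 515, 88, 88, 672, 672, 259, 152, 88, 88, 672, 672,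
    259, 152, 88, 88, 88, 672, 672, 262, 152, 88, 672, 672, 261, 152, 88, 88, 88, 88, 152, 152,
    352, 352, 518, 352, 352, 517, 152, 289, 672, 352, 19, 289, 580, 289, 290, 289, 289, 290,
    289, 289, 56, 88, 56, 196, 196, 22, 88, 280, 196, 196, 280, 88, 152, 292, 56, 194, 56, 194,
    88, 152, 56, 280, 196, 56, 193, 196, 448, 56, 196, 56, 56, 88, 152, 152, 88, 290, 292, 292,
    88, 152, 88, 292, 290, 290, 290, 88, 152, 289, 88, 152, 289, 289, 289, 88, 152, 152, 289,
    289, 289, 88, 152, 292, 152, 289, 88, 152, 88, 88, 152, 289, 289, 289, 88, 88, 88, 152, 88,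
    88, 292, 292, 290, 290, 152, 152, 289, 289, 152, 152, 88, 152, 88, 152, 88, 88, 152, 88, 88,
    88, 152, 290, 290, 152, 88, 88, 88, 152, 289, 289, 56, 280, 196, 196, 56, 56, 280, 88, 152,
    88, 88, 88, 88, 88, 152, 152, 88, 152, 88, 88, 88, 88, 88, 88, 56, 194, 56, 194, 56, 194,
    280, 194, 56, 193, 194, 448, 194, 56, 56, 194, 56, 194, 56, 56, 56, 280, 56, 56, 196, 196,
    194, 194, 280, 280, 193, 193, 280, 280, 280, 194, 194, 280, 56, 56, 56, 280, 193, 193, 88,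
    152, 152, 292, 88, 88, 152, 56, 280, 56, 56, 88, 152, 88, 290, 292, 88, 152, 290, 152, 152,
    289, 152, 152, 88, 152, 88, 152, 88, 88, 152, 152, 88, 152, 88, 88, 88, 152, 290, 88, 88,
    152, 289, 88, 88, 88, 88, 88, 152, 88, 88, 88, 88, 88, 56, 193, 28, 21, 56, 56, 280, 280,
    280, 56, 280, 280, 56, 56, 56, 56, 280, 280, 56, 56, 56, 56, 56, 56, 280, 56, 56, 280, 56,
    280, 56, 280, 56, 280, 56, 56, 56, 56, 56, 56, 7]).isSome = true := by
  decide +kernel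

set_option maxRecDepth 10000 in
theorem refute_two_through_pair : (refute 3 4 40 (start 3 4 6 [51, 15])
    [11, 35, 7, 7, 168, 168, 392, 44, 392, 392, 392, 168, 224, 56, 224, 224, 224, 7, 56, 104,
    56, 56, 7, 1544, 13, 1544, 13, 7, 7, 776, 392, 52, 392, 392, 13, 22, 392, 776, 35, 776, 7,
    224, 224, 224, 7, 56, 56, 104, 7, 104, 56, 19, 7, 35, 13, 7, 7, 7, 56, 56, 7, 7, 7, 56, 19,
    7, 7, 7, 104, 104, 328, 44, 328, 328, 328, 7, 104, 56, 104, 7, 56, 7, 7, 7, 104, 56, 328,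
    328, 328, 7, 7, 7, 56, 56, 7, 7, 7, 168, 7, 7, 35, 35, 21, 148, 84, 28, 35, 35, 35, 84, 84,
    148, 35, 35, 84, 35, 35, 35, 35, 35, 35, 11, 21, 35, 35, 35, 35, 19, 11, 11, 11, 11, 19, 19,
    19, 11]).isSome = true := by
  decide +kernel

theorem refute_linear : (refute 2 4 40 (start 2 4 4 [15])
    [7, 11, 7, 7, 7, 7, 11, 11, 11]).isSome = true := by
  decide +kernel

end Diversity.Search

/-! ### Excluding large intersections. -/

namespace Diversity

variable {α : Type*} [DecidableEq α] {F : Finset (Finset α)}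

open Search

theorem card_inter_lt_of_sized {E E' : Finset α} (hE : E.card = 4) (hE' : E'.card = 4)
    (hne : E ≠ E') : (E ∩ E').card < 4 := by
  by_contra h
  have h1 : E ∩ E' = E := Finset.eq_of_subset_of_card_le Finset.inter_subset_left (by omega)
  have h2 : E ∩ E' = E' := Finset.eq_of_subset_of_card_le Finset.inter_subset_right (by omega)
  exact hne (h1.symm.trans h2)

theorem exists_eq_insert_of_triple {E t : Finset α} (hE : E.card = 4) (ht : t.card = 3)
    (h : t ⊆ E) : ∃ x ∉ t, E = insert x t := by
  obtain ⟨x, hx, h⟩ := Finset.exists_eq_insert_iff.2 ⟨h, by omega⟩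
  exact ⟨x, hx, h.symm⟩

theorem Spread.three_edges (hF : Spread F 4 4) : Spread F 4 3 where
  __ := hF
  card_inter_inter_lt := by
    intro E₁ h₁ E₂ h₂ E₃ h₃ h12 h13 h23
    by_contra h
    obtain ⟨t, ht, htc⟩ := Finset.exists_subset_card_eq (not_lt.1 h)
    simp only [Finset.subset_inter_iff] at ht
    obtain ⟨x, hx, rfl⟩ := exists_eq_insert_of_triple (hF.card_eq _ h₁) htc ht.1
    obtain ⟨y, hy, rfl⟩ := exists_eq_insert_of_triple (hF.card_eq _ h₂) htc ht.2.1
    obtain ⟨z, hz, rfl⟩ := exists_eq_insert_of_triple (hF.card_eq _ h₃) htc ht.2.2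
    obtain ⟨p, q, r, hpq, hpr, hqr, rfl⟩ := Finset.card_eq_three.1 htc
    have hxy : x ≠ y := by rintro rfl; exact h12 rfl
    have hxz : x ≠ z := by rintro rfl; exact h13 rfl
    have hyz : y ≠ z := by rintro rfl; exact h23 rfl
    simp only [Finset.mem_insert, Finset.mem_singleton, not_or] at hx hy hz
    obtain ⟨hxp, hxq, hxr⟩ := hx
    obtain ⟨hyp, hyq, hyr⟩ := hy
    obtain ⟨hzp, hzq, hzr⟩ := hz
    refine false_of_refute (l := [z, y, x, r, q, p]) hF ?_ rfl
      [insert z {p, q, r}, insert y {p, q, r}, insert x {p, q, r}] ?_ ?_ ?_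
      refute_three_through_triple
    · grind
    · simp [code]
      grind
    · decide
    · simp [*, Finset.subset_iff]

/-- Edges avoiding `t` must contain `x` and `y`. If no two of them shared a third point, they would
form a sunflower with kernel `{x, y}` and at least four petals. An edge `E` avoiding `x` and `y`
meets every petal, so all four points of `E` lie in petals, outside `t`; but then `E` misses `insert
x t`. -/
theorem Spread.exists_chain (hF : Spread F 4 3) {t : Finset α} (ht : t.card = 3) {x y : α}
    (hxy : x ≠ y) (hx : x ∉ t) (hy : y ∉ t) (hxF : insert x t ∈ F) (hyF : insert y t ∈ F) :
    ∃ D ∈ avoiding F t, ∃ D' ∈ avoiding F t, D ≠ D' ∧ x ∈ D ∧ x ∈ D' ∧ y ∈ D ∧ y ∈ D' ∧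
      3 ≤ (D ∩ D').card := by
  have hmem : ∀ D ∈ avoiding F t, ∀ z, insert z t ∈ F → z ∈ D := by
    intro D hD z hz
    obtain ⟨hD, hDt⟩ := Finset.mem_filter.1 hD
    obtain ⟨w, hw⟩ := hF.inter_nonempty D hD _ hz
    obtain ⟨hwD, hw⟩ := Finset.mem_inter.1 hw
    rcases Finset.mem_insert.1 hw with rfl | hw
    · exact hwD
    · exact absurd hw (Finset.disjoint_left.1 hDt hwD)
  by_contra hno
  push Not at hno
  have hpair : ∀ D ∈ avoiding F t, ∀ D' ∈ avoiding F t, D ≠ D' → D ∩ D' = {x, y} := by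
    intro D hD D' hD' hne
    have := hno D hD D' hD' hne (hmem D hD x hxF) (hmem D' hD' x hxF) (hmem D hD y hyF)
      (hmem D' hD' y hyF)
    refine (Finset.eq_of_subset_of_card_le ?_ ?_).symm
    · intro w hw
      rcases Finset.mem_insert.1 hw with rfl | hw
      · exact Finset.mem_inter.2 ⟨hmem D hD _ hxF, hmem D' hD' _ hxF⟩
      · rw [Finset.mem_singleton] at hw
        subst hw
        exact Finset.mem_inter.2 ⟨hmem D hD _ hyF, hmem D' hD' _ hyF⟩
    · rw [Finset.card_pair hxy]
      omega
  obtain ⟨p, hp⟩ : t.Nonempty := Finset.card_pos.1 (by omega)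
  obtain ⟨E, hE⟩ : (avoiding F {x, y, p}).Nonempty :=
    Finset.card_pos.1 (by have := hF.four_le {x, y, p} Finset.card_le_three; omega)
  obtain ⟨hE, hEd⟩ := Finset.mem_filter.1 hE
  simp only [Finset.disjoint_insert_right, Finset.disjoint_singleton_right] at hEd
  have hEn : ∀ D ∈ avoiding F t, ∃ z, z ∈ E ∩ D := fun D hD =>
    hF.inter_nonempty E hE D (Finset.mem_filter.1 hD).1
  have : Nonempty α := ⟨x⟩
  choose! f hf using hEn
  have himg : (avoiding F t).image f = E := by
    refine Finset.eq_of_subset_of_card_le ?_ ?_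
    · intro z hz
      obtain ⟨D, hD, rfl⟩ := Finset.mem_image.1 hz
      exact (Finset.mem_inter.1 (hf D hD)).1
    · rw [Finset.card_image_of_injOn, hF.card_eq E hE]
      · exact hF.four_le t ht.le
      · intro D hD D' hD' he
        by_contra hne
        have h1 := Finset.mem_inter.1 (hf D hD)
        have h2 := Finset.mem_inter.1 (hf D' hD')
        have h3 : f D ∈ D ∩ D' := Finset.mem_inter.2 ⟨h1.2, by rw [he]; exact h2.2⟩
        rw [hpair D hD D' hD' hne, Finset.mem_insert, Finset.mem_singleton] at h3
        rcases h3 with h3 | h3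
        · exact hEd.1 (h3 ▸ h1.1)
        · exact hEd.2.1 (h3 ▸ h1.1)
  obtain ⟨w, hw⟩ := hF.inter_nonempty E hE _ hxF
  obtain ⟨hwE, hw⟩ := Finset.mem_inter.1 hw
  rcases Finset.mem_insert.1 hw with rfl | hw
  · exact hEd.1 hwE
  · rw [← himg] at hwE
    obtain ⟨D, hD, rfl⟩ := Finset.mem_image.1 hwE
    exact Finset.disjoint_left.1 (Finset.mem_filter.1 hD).2 (Finset.mem_inter.1 (hf D hD)).2 hw

theorem Spread.two_edges_triple (hF : Spread F 4 3) : Spread F 3 4 where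
  __ := hF
  card_inter_inter_lt := fun E₁ h₁ E₂ h₂ E₃ h₃ h12 h13 h23 =>
    (hF.card_inter_inter_lt E₁ h₁ E₂ h₂ E₃ h₃ h12 h13 h23).trans (by norm_num)
  card_inter_lt := by
    intro E hE E' hE' hne
    by_contra h
    obtain ⟨t, ht, htc⟩ := Finset.exists_subset_card_eq (not_lt.1 h)
    rw [Finset.subset_inter_iff] at ht
    obtain ⟨x, hx, rfl⟩ := exists_eq_insert_of_triple (hF.card_eq _ hE) htc ht.1
    obtain ⟨y, hy, rfl⟩ := exists_eq_insert_of_triple (hF.card_eq _ hE') htc ht.2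
    have hxy : x ≠ y := by rintro rfl; exact hne rfl
    obtain ⟨D, hD, D', hD', hDD, hxD, hxD', hyD, hyD', hc⟩ := hF.exists_chain htc hxy hx hy hE hE'
    obtain ⟨hDF, hDt⟩ := Finset.mem_filter.1 hD
    obtain ⟨hDF', hDt'⟩ := Finset.mem_filter.1 hD'
    have hc3 : (D ∩ D').card = 3 := by
      have := hF.card_inter_lt D hDF D' hDF' hDD
      omega
    obtain ⟨u, hu, huD⟩ := Finset.exists_eq_insert_iff.2
      (⟨by simp [Finset.insert_subset_iff, *], by rw [hc3, Finset.card_pair hxy]⟩ :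
        ({x, y} : Finset α) ⊆ D ∩ D' ∧ ({x, y} : Finset α).card + 1 = (D ∩ D').card)
    obtain ⟨v, hv, hDe⟩ := exists_eq_insert_of_triple (hF.card_eq _ hDF) hc3 Finset.inter_subset_left
    obtain ⟨w, hw, hDe'⟩ :=
      exists_eq_insert_of_triple (hF.card_eq _ hDF') hc3 Finset.inter_subset_right
    have hvw : v ≠ w := by
      rintro rfl
      exact hDD (hDe.trans hDe'.symm)
    rw [← huD] at hDe hDe' hv hw
    obtain ⟨p, q, r, hpq, hpr, hqr, rfl⟩ := Finset.card_eq_three.1 htc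
    subst hDe hDe'
    have hl : [w, v, u, y, x, r, q, p].Nodup := by
      simp only [Finset.disjoint_insert_right, Finset.disjoint_singleton_right, Finset.mem_insert,
        Finset.mem_singleton, not_or] at *
      grind
    refine false_of_refute hF hl rfl
      [{w, u, x, y}, {v, u, x, y}, {y, p, q, r}, {x, p, q, r}] ?_ ?_ ?_ refute_chain_of_triples
    · simp only [List.nodup_cons, List.mem_cons, not_or] at hl
      simp [code]
      grind
    · decide
    · simp only [List.forall_mem_cons, hDF, hDF', hE, hE', true_and]
      simp [Finset.subset_iff]

theorem Spread.two_edges_pair (hF : Spread F 3 4) : Spread F 2 4 where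
  __ := hF
  card_inter_lt := by
    intro E hE E' hE' hne
    by_contra h
    have hc : (E ∩ E').card = 2 := by
      have := hF.card_inter_lt E hE E' hE' hne
      omega
    have h1 : (E \ E').card = 2 := by
      have := Finset.card_inter_add_card_sdiff E E'
      have := hF.card_eq E hE
      omega
    have h2 : (E' \ E).card = 2 := by
      have := Finset.card_inter_add_card_sdiff E' E
      have := hF.card_eq E' hE'
      rw [Finset.inter_comm] at hc
      omega
    obtain ⟨x, y, hxy, hI⟩ := Finset.card_eq_two.1 hc
    obtain ⟨p, q, hpq, hP⟩ := Finset.card_eq_two.1 h1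
    obtain ⟨r, s, hrs, hR⟩ := Finset.card_eq_two.1 h2
    have hE₁ : E = {x, y, p, q} := by
      rw [← Finset.sdiff_union_inter E E', hI, hP]
      grind
    have hE₂ : E' = {x, y, r, s} := by
      rw [← Finset.sdiff_union_inter E' E, Finset.inter_comm, hI, hR]
      grind
    have hl : [s, r, q, p, y, x].Nodup := by
      have hp : p ∈ E \ E' := by simp [hP]
      have hq : q ∈ E \ E' := by simp [hP]
      have hr : r ∈ E' \ E := by simp [hR]
      have hs : s ∈ E' \ E := by simp [hR]
      have hx : x ∈ E ∩ E' := by simp [hI]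
      have hy : y ∈ E ∩ E' := by simp [hI]
      grind
    refine false_of_refute hF hl rfl [{x, y, r, s}, {x, y, p, q}] ?_ ?_ ?_ refute_two_through_pair
    · simp only [List.nodup_cons, List.mem_cons, not_or] at hl
      simp [code]
      grind
    · decide
    · simp [← hE₁, ← hE₂, hE, hE']
      simp [hE₁, hE₂, Finset.subset_iff]

theorem not_spread (hF : Spread F 4 4) : False := by
  have h := hF.three_edges.two_edges_triple.two_edges_pair
  obtain ⟨E, hE⟩ : (avoiding F ∅).Nonempty :=
    Finset.card_pos.1 (by have := h.four_le ∅ (by simp); omega)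
  have hE := (Finset.mem_filter.1 hE).1
  obtain ⟨t, ht, htc⟩ := Finset.exists_subset_card_eq (show 3 ≤ E.card by rw [h.card_eq E hE]; norm_num)
  obtain ⟨x, hx, rfl⟩ := exists_eq_insert_of_triple (h.card_eq _ hE) htc ht
  obtain ⟨p, q, r, hpq, hpr, hqr, rfl⟩ := Finset.card_eq_three.1 htc
  refine false_of_refute (l := [x, r, q, p]) h ?_ rfl [insert x {p, q, r}] ?_ ?_ ?_ refute_linear
  · grind
  · simp [code]
  · decide
  · simp [*, Finset.subset_iff]

end Diversity

namespace Diversity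

theorem exists_card_avoiding_le_three {n : ℕ} (hn : 3 ≤ n) {F : Finset (Finset (Fin n))}
    (h4 : (F : Set (Finset (Fin n))).Sized 4) (hI : (F : Set (Finset (Fin n))).Intersecting) :
    ∃ S : Finset (Fin n), S.card = 3 ∧ (avoiding F S).card ≤ 3 := by
  by_contra! h
  have hpair : ∀ E ∈ F, ∀ E' ∈ F, E ≠ E' → (E ∩ E').card < 4 := fun E hE E' hE' =>
    card_inter_lt_of_sized (h4 hE) (h4 hE')
  refine not_spread (F := F) ⟨fun E hE => h4 hE, fun E hE E' hE' => ?_, fun S hS => ?_, hpair,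
    fun E₁ h₁ E₂ h₂ E₃ h₃ h12 _ _ => ?_⟩
  · exact Finset.not_disjoint_iff_nonempty_inter.1 (hI hE hE')
  · obtain ⟨S', hSS', hS'⟩ := Finset.exists_superset_card_eq hS (by simpa using hn)
    refine (h S' hS').trans_le (Finset.card_le_card fun E hE => ?_)
    obtain ⟨hE, hd⟩ := Finset.mem_filter.1 hE
    exact Finset.mem_filter.2 ⟨hE, hd.mono_right hSS'⟩
  · refine (Finset.card_le_card ?_).trans_lt (hpair E₁ h₁ E₂ h₂ h12)
    exact Finset.inter_subset_inter_left Finset.inter_subset_left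

theorem diversity_three_le_three {n : ℕ} (hn : 3 ≤ n) {F : Finset (Finset (Fin n))}
    (h4 : (F : Set (Finset (Fin n))).Sized 4) (hI : (F : Set (Finset (Fin n))).Intersecting) :
    diversity 3 F ≤ 3 := by
  obtain ⟨S, hS, hle⟩ := exists_card_avoiding_le_three hn h4 hI
  have h : diversity 3 F ≤ (avoiding F S).card := Nat.sInf_le ⟨S, hS, rfl⟩
  exact h.trans hle

/-- The line `{i, i + 1, i + 3, i + 9}`. -/
def line (i : Fin 13) : Finset (Fin 13) := {i, i + 1, i + 3, i + 9}

theorem mem_plane {A : Finset (Fin 13)} : A ∈ planeOfOrderThree ↔ ∃ i, line i = A := by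
  simp [planeOfOrderThree, line]

theorem line_injective : Function.Injective line := by
  decide +kernel

theorem card_line (i : Fin 13) : (line i).card = 4 := by
  revert i
  decide +kernel

theorem sized_plane : (planeOfOrderThree : Set (Finset (Fin 13))).Sized 4 := by
  intro A hA
  obtain ⟨i, rfl⟩ := mem_plane.1 hA
  exact card_line i

theorem existsUnique_line : ∀ x y : Fin 13, x ≠ y →
    ∃ i, (x ∈ line i ∧ y ∈ line i) ∧ ∀ j, x ∈ line j ∧ y ∈ line j → j = i := by
  decide +kernel

theorem isProjectivePlaneOfOrder_plane : IsProjectivePlaneOfOrder 3 planeOfOrderThree := by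
  refine ⟨by norm_num, by simp, sized_plane, fun x y hxy => ?_⟩
  obtain ⟨i, hi, hu⟩ := existsUnique_line x y hxy
  refine ⟨line i, ⟨mem_plane.2 ⟨i, rfl⟩, hi⟩, ?_⟩
  rintro A ⟨hA, h⟩
  obtain ⟨j, rfl⟩ := mem_plane.1 hA
  rw [hu j h]

theorem intersecting_plane : (planeOfOrderThree : Set (Finset (Fin 13))).Intersecting := by
  have key : ∀ i j : Fin 13, ¬ Disjoint (line i) (line j) := by decide +kernel
  intro A hA B hB
  obtain ⟨i, rfl⟩ := mem_plane.1 hA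
  obtain ⟨j, rfl⟩ := mem_plane.1 hB
  exact key i j

theorem card_avoiding_plane (S : Finset (Fin 13)) :
    (avoiding planeOfOrderThree S).card =
      (Finset.univ.filter fun i => Disjoint (line i) S).card := by
  rw [← Finset.card_image_of_injective _ line_injective]
  congr 1
  ext A
  simp only [avoiding, Finset.mem_filter, mem_plane, Finset.mem_image, Finset.mem_univ, true_and]
  constructor
  · rintro ⟨⟨i, rfl⟩, h⟩
    exact ⟨i, h, rfl⟩
  · rintro ⟨i, h, rfl⟩
    exact ⟨⟨i, rfl⟩, h⟩

theorem three_le_card_avoiding_plane {S : Finset (Fin 13)} (hS : S.card = 3) :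
    3 ≤ (avoiding planeOfOrderThree S).card := by
  have key : ∀ x y z : Fin 13,
      3 ≤ (Finset.univ.filter fun i => x ∉ line i ∧ y ∉ line i ∧ z ∉ line i).card := by
    decide +kernel
  obtain ⟨x, y, z, -, -, -, rfl⟩ := Finset.card_eq_three.1 hS
  rw [card_avoiding_plane]
  simpa using key x y z

theorem diversity_plane : diversity 3 planeOfOrderThree = 3 := by
  refine le_antisymm (diversity_three_le_three (by norm_num) sized_plane intersecting_plane) ?_
  refine le_csInf ⟨_, {0, 1, 2}, by decide, rfl⟩ ?_
  rintro d ⟨S, hS, rfl⟩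
  exact three_le_card_avoiding_plane hS

theorem coveringNumber_plane : coveringNumber planeOfOrderThree = 4 := by
  have h0 : IsTransversal planeOfOrderThree (line 0) := fun A hA =>
    Finset.not_disjoint_iff_nonempty_inter.1 (intersecting_plane hA (mem_plane.2 ⟨0, rfl⟩))
  refine le_antisymm (Nat.sInf_le ⟨line 0, h0, card_line 0⟩)
    (le_csInf ⟨4, line 0, h0, card_line 0⟩ ?_)
  rintro t ⟨T, hT, rfl⟩
  by_contra h
  obtain ⟨S, hTS, hS⟩ := Finset.exists_superset_card_eq (show T.card ≤ 3 by omega)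
    (show 3 ≤ Fintype.card (Fin 13) by simp)
  obtain ⟨A, hA⟩ : (avoiding planeOfOrderThree S).Nonempty :=
    Finset.card_pos.1 (by have := three_le_card_avoiding_plane hS; omega)
  obtain ⟨hA, hd⟩ := Finset.mem_filter.1 hA
  exact Finset.not_disjoint_iff_nonempty_inter.2 (hT A hA) (hd.mono_right hTS)

theorem isGreatest_diversityValues : IsGreatest (diversityValues 3 4) 3 := by
  refine ⟨⟨13, planeOfOrderThree, sized_plane, intersecting_plane, coveringNumber_plane,
    diversity_plane⟩, ?_⟩
  rintro d ⟨n, F, h4, hI, -, rfl⟩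
  rcases lt_or_ge n 3 with hn | hn
  · have : {d : ℕ | ∃ S : Finset (Fin n), S.card = 3 ∧ (avoiding F S).card = d} = ∅ := by
      refine Set.eq_empty_of_forall_notMem ?_
      rintro d ⟨S, hS, -⟩
      have := S.card_le_univ
      simp only [Fintype.card_fin] at this
      omega
    rw [diversity, this, Nat.sInf_empty]
    norm_num
  · exact diversity_three_le_three hn h4 hI

end Diversity

theorem mainTheorem4 :
    (∀ (n : ℕ), 3 ≤ n → ∀ F : Finset (Finset (Fin n)),
      (F : Set (Finset (Fin n))).Sized 4 → (F : Set (Finset (Fin n))).Intersecting →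
        Diversity.diversity 3 F ≤ 3) ∧
    IsGreatest (Diversity.diversityValues 3 4) 3 ∧
    (Diversity.IsProjectivePlaneOfOrder 3 Diversity.planeOfOrderThree ∧
      (Diversity.planeOfOrderThree : Set (Finset (Fin 13))).Intersecting ∧
      Diversity.coveringNumber Diversity.planeOfOrderThree = 4 ∧
      Diversity.diversity 3 Diversity.planeOfOrderThree = 3) :=
  ⟨fun _ hn _ h4 hI => Diversity.diversity_three_le_three hn h4 hI,
    Diversity.isGreatest_diversityValues, Diversity.isProjectivePlaneOfOrder_plane,
    Diversity.intersecting_plane, Diversity.coveringNumber_plane, Diversity.diversity_plane⟩
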